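/- For binary strings $w,x$ let $\mathrm{occ}(w,x)$ be the number of strings $u$ such that $uw$ is a prefix of $x$. A binary sequence $S\in\{0,1\}^{\omega}$ is \emph{(Borel) normal} if $\lim_{n\to\infty}\mathrm{occ}(w,S\upharpoonright n)/n=2^{-|w|}$ for every $w\in\{0,1\}^*$, where $S\upharpoonright n$ is the prefix of $S$ of length $n$. For $T:\{0,1\}^*\to\{0,1\}^*$ the \emph{worst-case compression ratio} of $T$ on $S$ is $R_T(S)=\limsup_{n\to\infty}|T(S\upharpoonright n)|/n$. The compressor $\mathrm{PPM}^*$ (escape probabilities by Method C, no exclusions) is as follows. After the prefix $x$ of the input has been read, a string $c$ is a \emph{context} of the model if some bit has followed $c$ in $x$, and either $c$ is empty or $c=wb$ with $b$ a bit and $\mathrm{occ}(w,x)\ge 2$. In the context $c$ a bit $b$ has frequency $\mathrm{occ}(cb,x)$, and the escape symbol has frequency the number of distinct bits that have followed $c$; the probability of a symbol is its frequency divided by the sum of the three frequencies. A context is \emph{deterministic} if its escape frequency is $1$. To encode the bit $b$ that follows $x$, the encoder starts in the shortest deterministic context that is a suffix of $x$, or in the longest context that is a suffix of $x$ if none of them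 is deterministic. If $b$ has been seen in the current context, $b$ is transmitted with its probability there; otherwise the escape symbol is transmitted with its probability and the next shorter context that is a suffix of $x$ becomes the current one. If there is no further context, $b$ is transmitted with probability $\tfrac12$. Arithmetic encoding starts with the interval $[0,1)$, and at each transmission replaces the current interval by the subinterval that belongs to the transmitted symbol, whose relative length is the probability of that symbol (symbols in the order $0,1,$ escape). If the final interval is $[a,b)$, the output $\mathrm{PPM}^*(x)$ consists of the $k=\lceil-\log_2(b-a)\rceil+1$ binary digits of the least multiple of $2^{-k}$ that is at least $a$ (this includes one bit of overhead). There exists a normal binary sequence $S$ such that $R_{\mathrm{PPM}^*}(S)=0$. -/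

import Mathlib

open Filter Topology
open scoped ENNReal

/-- The number of (possibly overlapping) occurrences of `w` as a substring of `x`, counted by their
starting positions: the number of prefixes `u` of `x` such that `u ++ w` is a prefix of `x`.
The empty string occurs `|x| + 1` times. -/
def occ (w x : List Bool) : ℕ :=
  ((Finset.range (x.length + 1)).filter (fun i => w <+: x.drop i)).card

/-- The prefix of length `n` of the binary sequence `S`. -/
def seqPrefix (S : ℕ → Bool) (n : ℕ) : List Bool :=
  (List.range n).map S

/-- Borel normality of a binary sequence. -/
def IsNormalSeq (S : ℕ → Bool) : Prop :=
  ∀ w : List Bool,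
    Tendsto (fun n : ℕ => (occ w (seqPrefix S n) : ℝ) / (n : ℝ)) atTop
      (𝓝 ((2 : ℝ)⁻¹ ^ w.length))

/-- The worst-case compression ratio of `T` on `S`: the upper limit of `|T (S ↾ n)| / n`,
taken in `[0, ∞]`. -/
noncomputable def worstCaseRatio (T : List Bool → List Bool) (S : ℕ → Bool) : ℝ≥0∞ :=
  limsup (fun n : ℕ => ((T (seqPrefix S n)).length : ℝ≥0∞) / (n : ℝ≥0∞)) atTop

namespace PPMStar

/-! ### The model after the input `x` has been read -/

/-- How often the bit `b` has followed the context `c` in the input `x`. -/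
def count (x c : List Bool) (b : Bool) : ℕ :=
  occ (c ++ [b]) x

/-- The frequency of the escape symbol in the context `c` (Method C): the number of distinct bits
that have followed `c`. -/
def escCount (x c : List Bool) : ℕ :=
  (if 0 < count x c false then 1 else 0) + (if 0 < count x c true then 1 else 0)

/-- The sum of the frequencies of the two bits and of the escape symbol in the context `c`. -/
def total (x c : List Bool) : ℕ :=
  count x c false + count x c true + escCount x c

/-- `c` is a context of the model: it predicts at least one bit, and it is either the empty context
or of the form `w ++ [b]` where `w` is not unique, that is, occurs at least twice in `x`. -/
def InModel (x c : List Bool) : Prop :=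
  0 < escCount x c ∧ (c = [] ∨ 2 ≤ occ c.dropLast x)

instance (x c : List Bool) : Decidable (InModel x c) :=
  inferInstanceAs (Decidable (0 < escCount x c ∧ (c = [] ∨ 2 ≤ occ c.dropLast x)))

/-- The relevant contexts: the suffixes of `x` that are contexts of the model, the longest first. -/
def relevant (x : List Bool) : List (List Bool) :=
  x.tails.filter (fun c => InModel x c)

/-- The contexts that are examined, one after the other, in encoding the bit that follows `x`: the
relevant contexts from the shortest deterministic one downwards, and all of them, starting with the
longest, if none is deterministic. -/
def codingContexts (x : List Bool) : List (List Bool) :=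
  match ((relevant x).filter (fun c => escCount x c = 1)).getLast? with
  | some c => (relevant x).dropWhile (fun d => d ≠ c)
  | none => relevant x

/-! ### Arithmetic encoding -/

/-- The half-open interval `[low, low + width)`. -/
structure Interval where
  /-- the left end point -/
  low : ℚ
  /-- the length -/
  width : ℚ

/-- The part of `I` that is taken up by a symbol of probability `p` if the symbols before it have
cumulative probability `q`. -/
def Interval.narrow (I : Interval) (q p : ℚ) : Interval :=
  ⟨I.low + I.width * q, I.width * p⟩

/-- Transmission of the bit `b` in the context `c`; the symbols are ordered `0`, `1`, escape. -/
def transmitBit (x c : List Bool) (b : Bool) (I : Interval) : Interval :=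
  I.narrow (if b then (count x c false : ℚ) / total x c else 0) ((count x c b : ℚ) / total x c)

/-- Transmission of the escape symbol in the context `c`. -/
def transmitEsc (x c : List Bool) (I : Interval) : Interval :=
  I.narrow (((count x c false + count x c true : ℕ) : ℚ) / total x c)
    ((escCount x c : ℚ) / total x c)

/-- Encoding of the bit `b` that follows `x`, through the given list of contexts: a context in which
`b` has been seen transmits `b`, any other one transmits an escape and hands over to the next. Below
the last context, the order `-1` table gives both bits the probability `1 / 2`. -/
def encodeIn (x : List Bool) (b : Bool) : List (List Bool) → Interval → Interval
  | [], I => I.narrow (if b then 1 / 2 else 0) (1 / 2)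
  | c :: cs, I =>
      if 0 < count x c b then transmitBit x c b I
      else encodeIn x b cs (transmitEsc x c I)

/-- Encoding of the remaining input, bit by bit, after `x` has been read. -/
def encodeFrom : List Bool → List Bool → Interval → Interval
  | _, [], I => I
  | x, b :: rest, I => encodeFrom (x ++ [b]) rest (encodeIn x b (codingContexts x) I)

/-- The final interval of the encoder on the input `x`. -/
def finalInterval (x : List Bool) : Interval :=
  encodeFrom [] x ⟨0, 1⟩

/-- The number of output bits: `⌈-log₂ width⌉`, and one bit of overhead. -/
noncomputable def codeLength (I : Interval) : ℕ :=
  ⌈-Real.logb 2 (I.width : ℝ)⌉₊ + 1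

/-- The first `k` binary digits of `N / 2 ^ k`, for `N < 2 ^ k`. -/
def binaryDigits (k N : ℕ) : List Bool :=
  (List.range k).map (fun i => N.testBit (k - 1 - i))

/-- The binary digits of the least number `c = N / 2 ^ k` with `low ≤ c`, for `k = codeLength I`.
As `2 ^ (1 - k) ≤ width`, the whole dyadic interval `[c, c + 2 ^ (-k))` lies in `I`. -/
noncomputable def output (I : Interval) : List Bool :=
  binaryDigits (codeLength I) ⌈I.low * 2 ^ codeLength I⌉₊

end PPMStar

/-- The compressor PPM*, with escape probabilities by Method C and without exclusions. -/
noncomputable def ppmStar (x : List Bool) : List Bool :=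
  PPMStar.output (PPMStar.finalInterval x)

/-! The sequence runs through stages. Stage `k` copies the periodic sequence `champ m`, `m =
blockLen k`, one period of which lists all `m`-bit strings as consecutive blocks. A word `w` has
exactly its expected frequency at every offset where it stays inside a block, so only about `|w|` of
the `m` offsets can disturb it. Up to boundary terms, the discrepancy over `n` positions of the
stage is at most `n |w| / m` plus one period (`abs_sum_occDev_stage`). Block lengths tend to
infinity, and the period of each stage after the first is at most the square root of its starting
position. Hence normality (`stagedSeq_normal`).

The same sparsity of periods makes the sequence compressible. Let `p` be the period of stage `k +
1`, and let `L` be slightly larger than `stageStart k + 2 p`. After `L + K p` bits of the stage, the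
last `L` bits have been seen at least `K` times before, and always with the same successor, even
where the earlier occurrence reaches into older stages (`stagedSeq_eq_of_context`). PPM* starts in
the shortest deterministic context. This is a suffix of the long one, so it has seen the correct bit
at least as often, and that bit gets probability at least `K / (K + 1)`
(`le_bitProb_of_deterministic`) and costs `O(1 / K)` digits.

Over a stage these costs form a harmonic sum, `O(p log n)`. The remaining `L + p` bits cost `O(log
n)` each, because at most one escape is ever sent (`le_bitProb`). As `stageStart k` and `p` are at
most `√n`, the whole prefix costs `O(√n log n)`, which is `o(n)`. -/

namespace PPMStar

/-! ### Widths of the coding intervals -/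

/-- The probability with which the bit `b` after `x` is encoded through a list of contexts. -/
def probIn (x : List Bool) (b : Bool) : List (List Bool) → ℚ
  | [] => 1 / 2
  | c :: cs =>
      if 0 < count x c b then (count x c b : ℚ) / total x c
      else (escCount x c : ℚ) / total x c * probIn x b cs

/-- The probability with which the bit `b` after `x` is encoded. -/
def bitProb (x : List Bool) (b : Bool) : ℚ :=
  probIn x b (codingContexts x)

theorem encodeIn_width (x : List Bool) (b : Bool) (cs : List (List Bool)) (I : Interval) :
    (encodeIn x b cs I).width = I.width * probIn x b cs := by
  induction cs generalizing I with
  | nil => rfl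
  | cons c cs ih =>
    unfold encodeIn probIn
    split_ifs
    · rfl
    · rw [ih]; simp only [transmitEsc, Interval.narrow]; ring

theorem encodeFrom_append (x l : List Bool) (b : Bool) (I : Interval) :
    encodeFrom x (l ++ [b]) I =
      encodeIn (x ++ l) b (codingContexts (x ++ l)) (encodeFrom x l I) := by
  induction l generalizing x I with
  | nil => simp [encodeFrom]
  | cons a l ih => simp [encodeFrom, ih]

theorem finalInterval_width_append (x : List Bool) (b : Bool) :
    (finalInterval (x ++ [b])).width = (finalInterval x).width * bitProb x b := by
  rw [finalInterval, encodeFrom_append, encodeIn_width]; rfl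

theorem output_length (I : Interval) : (output I).length = codeLength I := by
  simp [output, binaryDigits]

/-! ### Counts -/

theorem occ_le (w x : List Bool) : occ w x ≤ x.length + 1 := by
  refine (Finset.card_filter_le _ _).trans ?_
  simp

theorem total_le (x c : List Bool) : total x c ≤ 2 * x.length + 4 := by
  have h0 := occ_le (c ++ [false]) x
  have h1 := occ_le (c ++ [true]) x
  unfold total escCount count
  split_ifs <;> omega

theorem count_pos_of_escCount {x c : List Bool} (h0 : 0 < escCount x c) (h1 : escCount x c ≠ 1)
    (b : Bool) : 0 < count x c b := by
  unfold escCount at h0 h1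
  by_contra h
  cases b <;> split_ifs at h0 h1 <;> simp_all

/-- If `c = u ++ d`, moving a starting position by `|u|` maps occurrences injectively. -/
theorem occ_append_le_of_suffix {c d : List Bool} (h : d <:+ c) (v x : List Bool) :
    occ (c ++ v) x ≤ occ (d ++ v) x := by
  obtain ⟨u, rfl⟩ := h
  rcases eq_or_ne (d ++ v) [] with hd | hd
  · rw [hd]
    refine (occ_le _ _).trans ?_
    simp [occ]
  refine Finset.card_le_card_of_injOn (fun i => i + u.length) ?_ (fun a _ b _ => by simp)
  intro i hi
  simp only [Finset.coe_filter, Finset.mem_range, Set.mem_ofPred_eq] at hi ⊢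
  obtain ⟨h1, t, ht⟩ := hi
  have h2 := congrArg List.length ht
  simp only [List.length_append, List.length_drop] at h2
  have h3 : 0 < (d ++ v).length := List.length_pos_of_ne_nil hd
  simp only [List.length_append] at h3
  refine ⟨by omega, t, ?_⟩
  rw [← List.drop_drop, ← ht]
  simp

theorem count_le_of_suffix {c d : List Bool} (h : d <:+ c) (x : List Bool) (b : Bool) :
    count x c b ≤ count x d b :=
  occ_append_le_of_suffix h [b] x

theorem escCount_eq_one_of_count {x c : List Bool} {b : Bool} (h : 0 < count x c b)
    (h' : count x c (!b) = 0) : escCount x c = 1 := by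
  unfold escCount
  cases b <;> simp_all

theorem count_not_eq_zero {x c : List Bool} {b : Bool} (h : 0 < count x c b)
    (h1 : escCount x c = 1) : count x c (!b) = 0 := by
  unfold escCount at h1
  cases b <;> simp_all

theorem total_eq_succ {x c : List Bool} {b : Bool} (h : 0 < count x c b)
    (h1 : escCount x c = 1) : total x c = count x c b + 1 := by
  have := count_not_eq_zero h h1
  unfold total
  cases b <;> simp_all

/-! ### The list of examined contexts -/

theorem exists_split_of_getLast?_filter {α : Type*} {p : α → Bool} {l : List α} {c : α}
    (h : (l.filter p).getLast? = some c) :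
    ∃ l₁ l₂, l = l₁ ++ c :: l₂ ∧ p c = true ∧ ∀ d ∈ l₂, p d = false := by
  induction l with
  | nil => simp at h
  | cons a l ih =>
    rcases hl : (l.filter p).getLast? with _ | d
    · have hl' : l.filter p = [] := by simpa using hl
      by_cases ha : p a = true
      · simp only [List.filter_cons_of_pos ha, hl', List.getLast?_singleton, Option.some.injEq] at h
        subst h
        exact ⟨[], l, rfl, ha, by simpa using hl'⟩
      · simp [List.filter_cons_of_neg ha, hl'] at h
    · have : d = c := by
        by_cases ha : p a = true
        · rw [List.filter_cons_of_pos ha, List.getLast?_cons, hl] at h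
          simpa using h
        · rw [List.filter_cons_of_neg ha, hl] at h
          simpa using h
      subst this
      obtain ⟨l₁, l₂, rfl, h2⟩ := ih hl
      exact ⟨a :: l₁, l₂, rfl, h2⟩

theorem tails_pairwise_length {α : Type*} (x : List α) :
    x.tails.Pairwise (fun a b => b.length < a.length) := by
  induction x with
  | nil => simp
  | cons a x ih =>
    rw [List.tails_cons, List.pairwise_cons]
    refine ⟨fun b hb => ?_, ih⟩
    have := ((List.mem_tails _ _).1 hb).length_le
    simp; omega

theorem relevant_pairwise_length (x : List Bool) :
    (relevant x).Pairwise (fun a b => b.length < a.length) :=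
  (tails_pairwise_length x).filter _

theorem mem_relevant {x c : List Bool} : c ∈ relevant x ↔ c <:+ x ∧ InModel x c := by
  simp [relevant]

/-- Either all relevant contexts are examined and none is deterministic, or the first examined
context is the shortest deterministic one. -/
theorem codingContexts_cases (x : List Bool) :
    (codingContexts x = relevant x ∧ ∀ c ∈ relevant x, escCount x c ≠ 1) ∨
    ∃ c l, codingContexts x = c :: l ∧ c ∈ relevant x ∧ escCount x c = 1 ∧
      (∀ d ∈ l, d ∈ relevant x ∧ escCount x d ≠ 1) ∧
      ∀ d ∈ relevant x, escCount x d = 1 → c <:+ d := by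
  rcases h : ((relevant x).filter (fun c => escCount x c = 1)).getLast? with _ | c
  · left
    refine ⟨by rw [codingContexts, h], ?_⟩
    simpa using h
  · right
    obtain ⟨l₁, l₂, hl, hc, hd⟩ := exists_split_of_getLast?_filter h
    have hp := relevant_pairwise_length x
    rw [hl, List.pairwise_append, List.pairwise_cons] at hp
    have hne : ∀ d ∈ l₁, d ≠ c := by
      rintro d hd1 rfl
      exact lt_irrefl _ (hp.2.2 d hd1 d (by simp))
    have hmem : c ∈ relevant x := by simp [hl]
    refine ⟨c, l₂, ?_, hmem, by simpa using hc, ?_, ?_⟩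
    · rw [codingContexts, h]
      simp only
      rw [hl, List.dropWhile_append_of_pos (by simpa using hne)]
      simp
    · intro d hd2
      exact ⟨by simp [hl, hd2], by simpa using hd d hd2⟩
    -- Suffixes of the same string are nested, so being shortest means being a suffix of every other
    -- deterministic context.
    · intro d hdm hd1
      have hlen : c.length ≤ d.length := by
        have hdm' := hdm
        rw [hl, List.mem_append, List.mem_cons] at hdm'
        rcases hdm' with h1 | rfl | h1
        · exact (hp.2.2 d h1 c (by simp)).le
        · exact le_rfl
        · simpa [hd1] using hd d h1
      exact List.suffix_of_suffix_length_le (mem_relevant.1 hmem).1 (mem_relevant.1 hdm).1 hlen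

/-! ### Lower bounds for the coding probability -/

theorem inv_le_div_total {x c : List Bool} {a : ℕ} (ha : 0 < a) (ht : 0 < total x c) :
    (1 : ℚ) / (2 * x.length + 4) ≤ (a : ℚ) / total x c := by
  have h : (total x c : ℚ) ≤ 2 * x.length + 4 := by exact_mod_cast total_le x c
  have h1 : (1 : ℚ) ≤ a := by exact_mod_cast ha
  have h2 : (0 : ℚ) < total x c := by exact_mod_cast ht
  gcongr

theorem total_pos_of_escCount {x c : List Bool} (h : 0 < escCount x c) : 0 < total x c := by
  unfold total; omega

/-- A nondeterministic context of the model has seen both bits, so the first one in the list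
transmits `b` without an escape. -/
theorem le_probIn_of_nondeterministic {x : List Bool} (b : Bool) {l : List (List Bool)}
    (h : ∀ d ∈ l, d ∈ relevant x ∧ escCount x d ≠ 1) :
    (1 : ℚ) / (2 * x.length + 4) ≤ probIn x b l := by
  cases l with
  | nil =>
    unfold probIn
    gcongr
    have : (0 : ℚ) ≤ x.length := by positivity
    linarith
  | cons c l =>
    obtain ⟨h1, h2⟩ := h c (by simp)
    have h3 := (mem_relevant.1 h1).2.1
    have h4 := count_pos_of_escCount h3 h2 b
    rw [probIn, if_pos h4]
    exact inv_le_div_total h4 (total_pos_of_escCount h3)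

/-- At most two transmissions carry frequencies: an escape from the deterministic starting context,
then a symbol from a nondeterministic one. Hence the square. -/
theorem le_bitProb (x : List Bool) (b : Bool) :
    ((1 : ℚ) / (2 * x.length + 4)) ^ 2 ≤ bitProb x b := by
  have h0 : (0 : ℚ) ≤ 1 / (2 * x.length + 4) := by positivity
  have h1 : (1 : ℚ) / (2 * x.length + 4) ≤ 1 := by
    rw [div_le_one (by positivity)]
    have : (0 : ℚ) ≤ x.length := by positivity
    linarith
  rcases codingContexts_cases x with ⟨h, hn⟩ | ⟨c, l, h, hc, hc1, hl, -⟩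
  · rw [bitProb, h]
    refine le_trans ?_ (le_probIn_of_nondeterministic b fun d hd => ⟨hd, hn d hd⟩)
    nlinarith
  · have h3 := (mem_relevant.1 hc).2.1
    have ht := total_pos_of_escCount h3
    rw [bitProb, h, probIn]
    split_ifs with h4
    · refine le_trans ?_ (inv_le_div_total h4 ht)
      nlinarith
    · rw [pow_two]
      exact mul_le_mul (inv_le_div_total h3 ht) (le_probIn_of_nondeterministic b hl) h0
        (by positivity)

/-- If some deterministic context has predicted the bit `b` at least `k` times, then `b` has
probability at least `k / (k + 1)`. -/
theorem le_bitProb_of_deterministic {x c : List Bool} {b : Bool} {k : ℕ} (hk : 0 < k)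
    (hx : c <:+ x) (hcount : k ≤ count x c b) (hnot : count x c (!b) = 0)
    (hocc : 2 ≤ occ c.dropLast x) : (k : ℚ) / (k + 1) ≤ bitProb x b := by
  have hpos : 0 < count x c b := hk.trans_le hcount
  have hesc := escCount_eq_one_of_count hpos hnot
  have hmem : c ∈ relevant x := mem_relevant.2 ⟨hx, by omega, Or.inr hocc⟩
  rcases codingContexts_cases x with ⟨-, hn⟩ | ⟨d, l, h, hd, hd1, -, hmin⟩
  · exact absurd hesc (hn c hmem)
  -- The starting context `d` may be much shorter than `c`, but as a suffix of `c` it has seen `b`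
  -- too; being deterministic, it has never seen the other bit.
  · have h1 := hcount.trans (count_le_of_suffix (hmin c hmem hesc) x b)
    have hp : 0 < count x d b := hk.trans_le h1
    rw [bitProb, h, probIn, if_pos hp, total_eq_succ hp hd1]
    have h2 : (k : ℚ) ≤ count x d b := by exact_mod_cast h1
    push_cast
    rw [div_le_div_iff₀ (by positivity) (by positivity)]
    nlinarith

end PPMStar

/-! ### Occurrences in prefixes of a sequence -/

/-- The word `w` occurs in the sequence `S` at the position `i`. -/
def OccursAt (S : ℕ → Bool) (w : List Bool) (i : ℕ) : Prop :=
  ∀ j (h : j < w.length), S (i + j) = w[j]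

theorem seqPrefix_length (S : ℕ → Bool) (n : ℕ) : (seqPrefix S n).length = n := by
  simp [seqPrefix]

theorem seqPrefix_succ (S : ℕ → Bool) (n : ℕ) :
    seqPrefix S (n + 1) = seqPrefix S n ++ [S n] := by
  simp [seqPrefix, List.range_succ]

theorem prefix_drop_seqPrefix_iff {S : ℕ → Bool} {n i : ℕ} (hi : i ≤ n) (w : List Bool) :
    w <+: (seqPrefix S n).drop i ↔ i + w.length ≤ n ∧ OccursAt S w i := by
  rw [List.prefix_iff_getElem?]
  constructor
  · intro h
    have hlen : i + w.length ≤ n := by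
      by_contra hn
      have h1 : 0 < w.length := by omega
      have h2 := h (w.length - 1) (by omega)
      rw [List.getElem?_eq_none (by simp [seqPrefix]; omega)] at h2
      simp at h2
    refine ⟨hlen, fun j hj => ?_⟩
    have := h j hj
    rw [List.getElem?_drop, seqPrefix, List.getElem?_map, List.getElem?_range (by omega)] at this
    simpa using this
  · rintro ⟨h1, h2⟩ j hj
    rw [List.getElem?_drop, seqPrefix, List.getElem?_map, List.getElem?_range (by omega),
      ← h2 j hj]
    rfl

open Classical in
theorem occ_seqPrefix (S : ℕ → Bool) (n : ℕ) (w : List Bool) :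
    occ w (seqPrefix S n) =
      ((Finset.range (n + 1)).filter (fun i => i + w.length ≤ n ∧ OccursAt S w i)).card := by
  rw [occ, seqPrefix_length]
  congr 1
  ext i
  simp only [Finset.mem_filter, Finset.mem_range]
  refine and_congr_right fun hi => ?_
  rw [prefix_drop_seqPrefix_iff (by omega)]

/-- The last `L` bits of the prefix of length `n`. -/
def lastBits (S : ℕ → Bool) (n L : ℕ) : List Bool :=
  (List.range L).map (fun j => S (n - L + j))

theorem lastBits_length (S : ℕ → Bool) (n L : ℕ) : (lastBits S n L).length = L := by
  simp [lastBits]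

theorem lastBits_suffix {S : ℕ → Bool} {n L : ℕ} (h : L ≤ n) :
    lastBits S n L <:+ seqPrefix S n := by
  refine ⟨seqPrefix S (n - L), ?_⟩
  obtain ⟨a, rfl⟩ := Nat.exists_eq_add_of_le' h
  simp [seqPrefix, lastBits, List.range_add]

theorem occursAt_lastBits_append {S : ℕ → Bool} {n L : ℕ} (b : Bool) (i : ℕ) :
    OccursAt S (lastBits S n L ++ [b]) i ↔
      (∀ j < L, S (i + j) = S (n - L + j)) ∧ S (i + L) = b := by
  constructor
  · intro h
    constructor
    · intro j hj
      rw [h j (by simp [lastBits]; omega), List.getElem_append_left (by simpa [lastBits] using hj)]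
      simp [lastBits]
    · rw [h L (by simp [lastBits]), List.getElem_append_right (by simp [lastBits])]
      simp
  · rintro ⟨h1, h2⟩ j hj
    simp only [List.length_append, lastBits_length, List.length_singleton] at hj
    rcases Nat.lt_succ_iff_lt_or_eq.1 hj with h | rfl
    · rw [h1 j h, List.getElem_append_left (by simpa [lastBits] using h)]
      simp [lastBits]
    · rw [h2, List.getElem_append_right (by simp [lastBits])]
      simp

/-- The final occurrence of `c` has no successor yet, so it differs from the one followed by `b`. -/
theorem two_le_occ_dropLast_of_occ_append {c x : List Bool} {b : Bool} (hc : c ≠ [])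
    (hx : c <:+ x) (h : 0 < occ (c ++ [b]) x) : 2 ≤ occ c.dropLast x := by
  obtain ⟨i, hi⟩ := Finset.card_pos.1 h
  simp only [Finset.mem_filter, Finset.mem_range] at hi
  obtain ⟨hi, t, ht⟩ := hi
  obtain ⟨u, hu⟩ := hx
  have hlen := congrArg List.length ht
  have hlen' := congrArg List.length hu
  simp only [List.length_append, List.length_drop, List.length_singleton] at hlen hlen'
  have hcpos := List.length_pos_of_ne_nil hc
  have hpre : c.dropLast <+: c := List.dropLast_prefix c
  have hsub : ({i, u.length} : Finset ℕ) ⊆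
      (Finset.range (x.length + 1)).filter (fun i => c.dropLast <+: x.drop i) := by
    intro a ha
    simp only [Finset.mem_insert, Finset.mem_singleton] at ha
    simp only [Finset.mem_filter, Finset.mem_range]
    rcases ha with rfl | rfl
    · refine ⟨hi, hpre.trans ⟨[b] ++ t, ?_⟩⟩
      rw [← ht]; simp
    · refine ⟨by omega, hpre.trans ?_⟩
      rw [← hu]; simp
  have hne : i ≠ u.length := by omega
  calc 2 = ({i, u.length} : Finset ℕ).card := (Finset.card_pair hne).symm
    _ ≤ _ := Finset.card_le_card hsub

/-- Prediction from the past: if every earlier occurrence of the last `L` bits was followed by the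
same bit as now, and there were the occurrences at the distances `p, 2 p, …, k p`, then the next bit
has probability at least `k / (k + 1)`. -/
theorem le_bitProb_seqPrefix {S : ℕ → Bool} {n L p k : ℕ} (hL : 0 < L) (hp : 0 < p) (hk : 0 < k)
    (hn : L + k * p ≤ n)
    (hper : ∀ i, n - L - k * p ≤ i → i + p ≤ n → S (i + p) = S i)
    (hdet : ∀ e, L ≤ e → e < n → (∀ j, 0 < j → j ≤ L → S (e - j) = S (n - j)) → S e = S n) :
    (k : ℚ) / (k + 1) ≤ PPMStar.bitProb (seqPrefix S n) (S n) := by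
  classical
  -- The lower bound on `i` is `n - L`, written so that subtracting `k` periods stays in the range
  -- of `hper`. The value `i = n` is included: it gives the successor.
  have hmul : ∀ a ≤ k, ∀ i, n - L - k * p + k * p ≤ i → i ≤ n → S (i - a * p) = S i := by
    intro a
    induction a with
    | zero => simp
    | succ a ih =>
      intro ha i hi hin
      rw [← ih (by omega) i hi hin]
      have h1 : (a + 1) * p ≤ k * p := Nat.mul_le_mul_right _ ha
      rw [add_mul, one_mul] at h1 ⊢
      have := hper (i - (a * p + p)) (by omega) (by omega)
      rw [← this]
      congr 1
      omega
  have hcount : k ≤ PPMStar.count (seqPrefix S n) (lastBits S n L) (S n) := by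
    rw [PPMStar.count, occ_seqPrefix]
    calc k = (Finset.range k).card := (Finset.card_range k).symm
      _ ≤ _ := by
        refine Finset.card_le_card_of_injOn (fun a => n - L - (a + 1) * p) ?_ ?_
        · intro a ha
          have ha' : a < k := by simpa using ha
          have h1 : (a + 1) * p ≤ k * p := Nat.mul_le_mul_right _ ha'
          have h2 : 0 < (a + 1) * p := by positivity
          simp only [Finset.coe_filter, Finset.mem_range, Set.mem_ofPred_eq, List.length_append,
            lastBits_length, List.length_singleton]
          refine ⟨by omega, by omega, (occursAt_lastBits_append _ _).2 ⟨fun j hj => ?_, ?_⟩⟩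
          · rw [← hmul (a + 1) ha' (n - L + j) (by omega) (by omega)]
            congr 1; omega
          · rw [← hmul (a + 1) ha' n (by omega) le_rfl]
            congr 1; omega
        · intro a ha b hb hab
          have ha' : a < k := by simpa using ha
          have hb' : b < k := by simpa using hb
          have h1 : (a + 1) * p ≤ k * p := Nat.mul_le_mul_right _ ha'
          have h2 : (b + 1) * p ≤ k * p := Nat.mul_le_mul_right _ hb'
          have h3 : (a + 1) * p = (b + 1) * p := by simp only at hab; omega
          have := Nat.eq_of_mul_eq_mul_right hp h3
          omega
  have hnot : PPMStar.count (seqPrefix S n) (lastBits S n L) (!(S n)) = 0 := by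
    rw [PPMStar.count, occ_seqPrefix, Finset.card_eq_zero, Finset.filter_eq_empty_iff]
    rintro i - ⟨h1, h2⟩
    simp only [List.length_append, lastBits_length, List.length_singleton] at h1
    rw [occursAt_lastBits_append] at h2
    have := hdet (i + L) (by omega) (by omega) (fun j hj0 hj => by
      have := h2.1 (L - j) (by omega)
      convert this using 2 <;> omega)
    rw [this] at h2
    simp at h2
  have hLn : L ≤ n := by omega
  refine PPMStar.le_bitProb_of_deterministic hk (lastBits_suffix hLn) hcount hnot ?_
  refine two_le_occ_dropLast_of_occ_append (b := S n) ?_ (lastBits_suffix hLn)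
    (lt_of_lt_of_le hk hcount)
  intro h
  have := congrArg List.length h
  simp [lastBits_length] at this
  omega

/-! ### The sequence -/

/-- The infinite concatenation of the binary expansions, with `m` digits and the least significant
digit first, of `0, 1, 2, …` modulo `2 ^ m`. -/
def champ (m n : ℕ) : Bool :=
  (n / m).testBit (n % m)

theorem champ_periodic {m : ℕ} (hm : 0 < m) : Function.Periodic (champ m) (m * 2 ^ m) := by
  intro n
  unfold champ
  rw [Nat.add_mul_div_left _ _ hm, Nat.add_mul_mod_self_left, add_comm,
    Nat.testBit_two_pow_add_gt (Nat.mod_lt _ hm)]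

theorem champ_self {m : ℕ} (hm : 0 < m) : champ m m = true := by
  simp [champ, Nat.div_self hm]

theorem champ_of_lt {m n : ℕ} (h : n < m) : champ m n = false := by
  simp [champ, Nat.div_eq_of_lt h]

/-- The length of the binary expansions in stage `k`; the period of stage `k` is
`blockLen (k + 1)`. -/
def blockLen : ℕ → ℕ
  | 0 => 1
  | k + 1 => blockLen k * 2 ^ blockLen k

/-- The position where stage `k` starts. -/
def stageStart : ℕ → ℕ
  | 0 => 0
  | k + 1 => (stageStart k + 4 * blockLen (k + 2)) ^ 2

/-- The stage that the position `n` belongs to. -/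
def stage (n : ℕ) : ℕ :=
  Nat.findGreatest (fun k => stageStart k ≤ n) n

/-- A normal sequence that PPM* compresses: it follows `champ (blockLen k)` in stage `k`. -/
def stagedSeq (n : ℕ) : Bool :=
  champ (blockLen (stage n)) n

theorem blockLen_pos (k : ℕ) : 0 < blockLen k := by
  induction k with
  | zero => simp [blockLen]
  | succ k ih => rw [blockLen]; positivity

theorem blockLen_strictMono : StrictMono blockLen := by
  refine strictMono_nat_of_lt_succ fun k => ?_
  rw [blockLen]
  exact lt_mul_of_one_lt_right (blockLen_pos k) (Nat.one_lt_two_pow (blockLen_pos k).ne')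

theorem stageStart_add_lt (k : ℕ) :
    stageStart k + 4 * blockLen (k + 2) < stageStart (k + 1) := by
  rw [stageStart]
  have := blockLen_pos (k + 2)
  nlinarith

theorem stageStart_strictMono : StrictMono stageStart :=
  strictMono_nat_of_lt_succ fun k => by have := stageStart_add_lt k; omega

theorem stage_eq {k n : ℕ} (h1 : stageStart k ≤ n) (h2 : n < stageStart (k + 1)) :
    stage n = k := by
  unfold stage
  rw [Nat.findGreatest_eq_iff]
  -- Strict monotonicity gives `k ≤ stageStart k`, so the search bound `n` in `stage` loses nothing.
  refine ⟨(stageStart_strictMono.id_le k).trans h1, fun _ => h1, fun j hj _ hle => ?_⟩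
  have := stageStart_strictMono.monotone (show k + 1 ≤ j from hj)
  omega

theorem stage_spec (n : ℕ) : stageStart (stage n) ≤ n ∧ n < stageStart (stage n + 1) := by
  constructor
  · exact Nat.findGreatest_spec (P := fun k => stageStart k ≤ n) (Nat.zero_le n) (by simp [stageStart])
  · by_contra! h
    have h1 := (stageStart_strictMono.id_le (stage n + 1)).trans h
    have : stage n + 1 ≤ stage n :=
      Nat.le_findGreatest (P := fun k => stageStart k ≤ n) (m := stage n + 1) h1 h
    omega

theorem le_stage {k n : ℕ} (h : stageStart k ≤ n) : k ≤ stage n :=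
  Nat.le_findGreatest (P := fun k => stageStart k ≤ n)
    ((stageStart_strictMono.id_le k).trans h) h

theorem tendsto_stage : Tendsto stage atTop atTop :=
  tendsto_atTop.2 fun k => (eventually_ge_atTop (stageStart k)).mono fun _ h => le_stage h

theorem stagedSeq_eq {k n : ℕ} (h1 : stageStart k ≤ n) (h2 : n < stageStart (k + 1)) :
    stagedSeq n = champ (blockLen k) n := by
  rw [stagedSeq, stage_eq h1 h2]

theorem stagedSeq_add_period {k n : ℕ} (h1 : stageStart k ≤ n)
    (h2 : n + blockLen (k + 1) < stageStart (k + 1)) :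
    stagedSeq (n + blockLen (k + 1)) = stagedSeq n := by
  rw [stagedSeq_eq h1 (by omega), stagedSeq_eq (by omega) h2]
  exact champ_periodic (blockLen_pos k) n

/-- No window of stage `k + 1` that is longer than its period has the period of stage `k`. -/
theorem exists_stagedSeq_ne {k a : ℕ} (h1 : stageStart (k + 1) + blockLen (k + 1) ≤ a)
    (h2 : a + blockLen (k + 2) ≤ stageStart (k + 2)) :
    ∃ i, a ≤ i ∧ i < a + blockLen (k + 2) ∧ stagedSeq i ≠ stagedSeq (i - blockLen (k + 1)) := by
  set m := blockLen (k + 1) with hm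
  have hm0 : 0 < m := blockLen_pos _
  have hp : blockLen (k + 2) = m * 2 ^ m := rfl
  have hper := champ_periodic hm0
  rw [← hp] at hper
  set p := blockLen (k + 2) with hpdef
  have hp0 : 0 < p := blockLen_pos _
  have hmp : m < p := blockLen_strictMono (Nat.lt_succ_self _)
  -- The least `i ≥ a` congruent to `m` modulo `p`, by rounding up.
  obtain ⟨i, hi1, hi2, q, hq⟩ : ∃ i, a ≤ i ∧ i < a + p ∧ ∃ q, i = m + q * p := by
    have h3 := Nat.div_add_mod (a - m + p - 1) p
    have h4 := Nat.mod_lt (a - m + p - 1) hp0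
    rw [mul_comm] at h3
    exact ⟨m + (a - m + p - 1) / p * p, by omega, by omega, _, rfl⟩
  refine ⟨i, hi1, hi2, ?_⟩
  rw [stagedSeq_eq (k := k + 1) (by omega) (show i < stageStart (k + 2) by omega),
    stagedSeq_eq (k := k + 1) (by omega) (show i - m < stageStart (k + 2) by omega), ← hm, hq]
  have h5 : m + q * p - m = 0 + q * p := by omega
  rw [h5]
  -- The period of stage `k` is the block length of stage `k + 1`, so the shift by `m` compares
  -- consecutive blocks: here the lowest digits of `1` and of `0`.
  have e1 : champ m (m + q * p) = champ m m := hper.nat_mul q m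
  have e2 : champ m (0 + q * p) = champ m 0 := hper.nat_mul q 0
  rw [e1, e2, champ_self hm0, champ_of_lt hm0]
  simp

/-- In stage `k + 1`, every earlier occurrence of a long context was followed by the same bit. -/
theorem stagedSeq_eq_of_context {k n e L : ℕ}
    (hL : L = stageStart k + 2 * blockLen (k + 2) + blockLen (k + 1))
    (hn : stageStart (k + 1) + L ≤ n) (hn' : n < stageStart (k + 2)) (he : L ≤ e) (hen : e < n)
    (h : ∀ j, 0 < j → j ≤ L → stagedSeq (e - j) = stagedSeq (n - j)) :
    stagedSeq e = stagedSeq n := by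
  have hp0 : 0 < blockLen (k + 2) := blockLen_pos _
  have hp0' : 0 < blockLen (k + 1) := blockLen_pos _
  have hpp : blockLen (k + 1) < blockLen (k + 2) := blockLen_strictMono (Nat.lt_succ_self _)
  have hM := stageStart_add_lt k
  have per' : ∀ i, stageStart k + blockLen (k + 1) ≤ i → i < stageStart (k + 1) →
      stagedSeq i = stagedSeq (i - blockLen (k + 1)) := by
    intro i h1 h2
    rw [← stagedSeq_add_period (k := k) (n := i - blockLen (k + 1)) (by omega) (by omega)]
    congr 1; omega
  have per : ∀ i, stageStart (k + 1) + blockLen (k + 2) ≤ i → i < stageStart (k + 2) →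
      stagedSeq i = stagedSeq (i - blockLen (k + 2)) := by
    intro i h1 h2
    have h3 : stagedSeq (i - blockLen (k + 2) + blockLen (k + 2)) =
        stagedSeq (i - blockLen (k + 2)) :=
      stagedSeq_add_period (k := k + 1) (by omega)
        (show i - blockLen (k + 2) + blockLen (k + 2) < stageStart (k + 2) by omega)
    rwa [Nat.sub_add_cancel (by omega)] at h3
  set p := blockLen (k + 2)
  set p' := blockLen (k + 1)
  rcases lt_or_ge e (stageStart (k + 1)) with h1 | h1
  -- The old context lies in stage `k` for at least `p + p'` bits. As in the Fine–Wilf argument, the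
  -- shifts by `p'` and `p` commute: go back by `p'` at `e`, by `p` at `n`, then forward by `p'` at
  -- `e` and by `p` at `n`.
  · rw [per' e (by omega) h1, h p' hp0' (by omega), per (n - p') (by omega) (by omega),
      Nat.sub_sub, ← h (p' + p) (by omega) (by omega), ← Nat.sub_sub, Nat.sub_right_comm,
      ← per' (e - p) (by omega) (by omega), h p hp0 (by omega), ← per n (by omega) hn']
  · rcases lt_or_ge e (stageStart (k + 1) + p) with h2 | h2
    -- The old context straddles the stage boundary. Its part before the boundary has period `p'`,
    -- and `L ≥ 2 p + p'` makes that part long enough to force this period on a window of length `p`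
    -- of stage `k + 1`.
    · exfalso
      obtain ⟨i, hi1, hi2, hne⟩ := exists_stagedSeq_ne (k := k)
        (a := n - (e - stageStart (k + 1)) - p) (by omega) (by omega)
      apply hne
      change i < n - (e - stageStart (k + 1)) - p + p at hi2
      change stagedSeq i = stagedSeq (i - p')
      have e1 := h (n - i) (by omega) (by omega)
      have e2 := h (n - i + p') (by omega) (by omega)
      rw [show n - (n - i) = i by omega] at e1
      rw [show n - (n - i + p') = i - p' by omega, ← Nat.sub_sub] at e2
      rw [← e1, ← e2]
      exact per' _ (by omega) (by omega)
    -- Both positions lie a full period inside stage `k + 1`.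
    · rw [per e h2 (by omega), h p hp0 (by omega), ← per n (by omega) hn']

/-- In stage `k + 1`, the bits after the first `L + p` ones are predicted well. -/
theorem le_bitProb_stagedSeq {k n L K : ℕ}
    (hL : L = stageStart k + 2 * blockLen (k + 2) + blockLen (k + 1)) (hK : 0 < K)
    (hn : stageStart (k + 1) + L + K * blockLen (k + 2) ≤ n) (hn' : n < stageStart (k + 2)) :
    (K : ℚ) / (K + 1) ≤ PPMStar.bitProb (seqPrefix stagedSeq n) (stagedSeq n) := by
  have hp0 : 0 < blockLen (k + 2) := blockLen_pos _
  refine le_bitProb_seqPrefix (L := L) (p := blockLen (k + 2)) (by omega) hp0 hK (by omega) ?_ ?_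
  · intro i h1 h2
    exact stagedSeq_add_period (k := k + 1) (by omega)
      (by rw [show k + 1 + 1 = k + 2 from rfl]; omega)
  · intro e h1 h2 h3
    exact stagedSeq_eq_of_context hL (by omega) hn' h1 h2 h3

/-! ### Normality -/

theorem occursAt_nil (S : ℕ → Bool) (i : ℕ) : OccursAt S [] i := by
  intro j hj
  simp at hj

theorem occursAt_cons {S : ℕ → Bool} {b : Bool} {w : List Bool} {i : ℕ} :
    OccursAt S (b :: w) i ↔ S i = b ∧ OccursAt S w (i + 1) := by
  constructor
  · intro h
    refine ⟨h 0 (by simp), fun j hj => ?_⟩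
    have := h (j + 1) (by simpa using hj)
    rw [show i + 1 + j = i + (j + 1) by omega, this]
    rfl
  · rintro ⟨h1, h2⟩ j hj
    cases j with
    | zero => exact h1
    | succ j =>
      rw [show i + (j + 1) = i + 1 + j by omega]
      exact h2 j (by simpa using hj)

theorem occursAt_congr {S T : ℕ → Bool} {w : List Bool} {i k : ℕ}
    (h : ∀ j < w.length, S (i + j) = T (k + j)) : OccursAt S w i ↔ OccursAt T w k :=
  forall₂_congr fun j hj => by rw [h j hj]

open Classical in
/-- The deviation from its mean of the indicator of an occurrence of `w` at `i`. -/
noncomputable def occDev (S : ℕ → Bool) (w : List Bool) (i : ℕ) : ℝ :=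
  (if OccursAt S w i then 1 else 0) - 2⁻¹ ^ w.length

theorem abs_occDev_le (S : ℕ → Bool) (w : List Bool) (i : ℕ) : |occDev S w i| ≤ 1 := by
  have h1 : (0 : ℝ) ≤ 2⁻¹ ^ w.length := by positivity
  have h2 : (2⁻¹ : ℝ) ^ w.length ≤ 1 := pow_le_one₀ (by norm_num) (by norm_num)
  unfold occDev
  rw [abs_le]
  split_ifs <;> constructor <;> linarith

theorem occDev_congr {S T : ℕ → Bool} {w : List Bool} {i k : ℕ}
    (h : ∀ j < w.length, S (i + j) = T (k + j)) : occDev S w i = occDev T w k := by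
  classical
  rw [occDev, occDev, if_congr (occursAt_congr h) rfl rfl]

/-! ### Discrepancy of one period of `champ` -/

theorem sum_range_two_mul (g : ℕ → ℝ) (n : ℕ) :
    ∑ v ∈ Finset.range (2 * n), g v = ∑ v ∈ Finset.range n, (g (2 * v) + g (2 * v + 1)) := by
  induction n with
  | zero => simp
  | succ n ih =>
    rw [show 2 * (n + 1) = 2 * n + 1 + 1 by ring, Finset.sum_range_succ, Finset.sum_range_succ, ih,
      Finset.sum_range_succ]
    ring

theorem occursAt_testBit_succ (v : ℕ) (w : List Bool) (r : ℕ) :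
    OccursAt (Nat.testBit v) w (r + 1) ↔ OccursAt (Nat.testBit (v / 2)) w r :=
  occursAt_congr fun j _ => by rw [show r + 1 + j = r + j + 1 by omega, Nat.testBit_succ]

open Classical in
-- Fixing `|w|` of the `m` digits leaves the others free. The induction splits off the lowest digit,
-- `v ↦ 2 v, 2 v + 1`.
theorem sum_occursAt_testBit (w : List Bool) (r m : ℕ) (h : r + w.length ≤ m) :
    ∑ v ∈ Finset.range (2 ^ m), (if OccursAt (Nat.testBit v) w r then (1 : ℝ) else 0) =
      2 ^ m * 2⁻¹ ^ w.length := by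
  induction m generalizing r w with
  | zero =>
    have : w = [] := List.eq_nil_of_length_eq_zero (by omega)
    subst this
    simp [occursAt_nil]
  | succ m ih =>
    have e1 : ∀ v, (2 * v + 1) / 2 = v := fun v => by omega
    have e0 : ∀ v, (2 * v) / 2 = v := fun v => by omega
    cases r with
    | succ r =>
      rw [pow_succ', sum_range_two_mul]
      simp only [occursAt_testBit_succ, e0, e1, Finset.sum_add_distrib]
      rw [ih w r (by omega)]
      ring
    | zero =>
      cases w with
      | nil => simp [occursAt_nil]
      | cons b w =>
        rw [pow_succ', sum_range_two_mul]
        simp only [occursAt_cons, occursAt_testBit_succ, e0, e1]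
        have hw := ih w 0 (by simp at h ⊢; omega)
        rw [List.length_cons, show (2 : ℝ) ^ (m + 1) * 2⁻¹ ^ (w.length + 1) =
          2 ^ m * 2⁻¹ ^ w.length by rw [pow_succ, pow_succ]; ring, ← hw]
        refine Finset.sum_congr rfl fun v _ => ?_
        cases b <;> simp [Nat.testBit_zero]

theorem sum_range_mul (g : ℕ → ℝ) (a b : ℕ) :
    ∑ i ∈ Finset.range (a * b), g i =
      ∑ v ∈ Finset.range a, ∑ r ∈ Finset.range b, g (v * b + r) := by
  induction a with
  | zero => simp
  | succ a ih => rw [add_mul, one_mul, Finset.sum_range_add, ih, Finset.sum_range_succ]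

theorem occDev_champ_periodic {m : ℕ} (hm : 0 < m) (w : List Bool) :
    Function.Periodic (occDev (champ m) w) (m * 2 ^ m) := fun i =>
  occDev_congr fun j _ => by
    rw [show i + m * 2 ^ m + j = i + j + m * 2 ^ m by ring, champ_periodic hm]

theorem abs_sum_le_card {ι : Type*} (s : Finset ι) {g : ι → ℝ} (h : ∀ i, |g i| ≤ 1) :
    |∑ i ∈ s, g i| ≤ s.card := by
  refine (Finset.abs_sum_le_sum_abs _ _).trans ?_
  simpa using Finset.sum_le_card_nsmul s _ 1 fun i _ => h i

theorem abs_sum_occDev_champ_period {m : ℕ} (hm : 0 < m) (w : List Bool) :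
    |∑ i ∈ Finset.range (m * 2 ^ m), occDev (champ m) w i| ≤ w.length * 2 ^ m := by
  -- Sum over all blocks for each offset `r` first: the sum vanishes unless `w` crosses the end of
  -- the block.
  rw [mul_comm m, sum_range_mul, Finset.sum_comm]
  have h1 : ∀ r ∈ Finset.range m,
      |∑ v ∈ Finset.range (2 ^ m), occDev (champ m) w (v * m + r)| ≤
        if m < r + w.length then (2 : ℝ) ^ m else 0 := by
    intro r hr
    split_ifs with h
    · refine (abs_sum_le_card _ fun v => abs_occDev_le _ _ _).trans ?_
      simp
    · have h2 : ∀ v, occDev (champ m) w (v * m + r) = occDev (Nat.testBit v) w r := by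
        intro v
        refine occDev_congr fun j hj => ?_
        rw [champ, add_assoc, Nat.add_comm (v * m), Nat.add_mul_div_right _ _ hm,
          Nat.add_mul_mod_self_right, Nat.div_eq_of_lt (by omega), Nat.mod_eq_of_lt (by omega),
          zero_add]
      simp only [h2]
      simp only [occDev, Finset.sum_sub_distrib]
      rw [sum_occursAt_testBit w r m (by omega)]
      simp
  refine (Finset.abs_sum_le_sum_abs _ _).trans ((Finset.sum_le_sum h1).trans ?_)
  rw [← Finset.sum_filter, Finset.sum_const, nsmul_eq_mul]
  gcongr
  calc ((Finset.range m).filter (fun r => m < r + w.length)).card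
      ≤ (Finset.Ico (m - w.length) m).card := Finset.card_le_card fun r => by
        simp only [Finset.mem_filter, Finset.mem_range, Finset.mem_Ico]; omega
    _ ≤ w.length := by rw [Nat.card_Ico]; omega

/-! ### Discrepancy of the staged sequence -/

theorem sum_range_shift_of_periodic {g : ℕ → ℝ} {p : ℕ} (hg : Function.Periodic g p) (a : ℕ) :
    ∑ i ∈ Finset.range p, g (a + i) = ∑ i ∈ Finset.range p, g i := by
  induction a with
  | zero => simp
  | succ a ih =>
    rw [← ih]
    have h1 := Finset.sum_range_succ (fun i => g (a + i)) p
    rw [Finset.sum_range_succ', hg a] at h1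
    simp only [add_zero, add_left_inj] at h1
    rw [← h1]
    exact Finset.sum_congr rfl fun i _ => by congr 1; ring

/-- Whole periods contribute `E` each, wherever they start; the incomplete one contributes at most
its length. -/
theorem abs_sum_le_of_periodic {g : ℕ → ℝ} {p : ℕ} {E : ℝ} (hp : 0 < p)
    (hg : Function.Periodic g p) (h1 : ∀ i, |g i| ≤ 1)
    (hE : |∑ i ∈ Finset.range p, g i| ≤ E) (a n : ℕ) :
    |∑ i ∈ Finset.range n, g (a + i)| ≤ n * (E / p) + p := by
  have hE0 : 0 ≤ E := (abs_nonneg _).trans hE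
  have hp' : (0 : ℝ) < p := by exact_mod_cast hp
  induction n using Nat.strong_induction_on generalizing a with
  | _ n ih =>
    rcases lt_or_ge n p with h | h
    · refine (abs_sum_le_card _ fun i => h1 _).trans ?_
      have h2 : (n : ℝ) ≤ p := by exact_mod_cast h.le
      have : 0 ≤ n * (E / p) := by positivity
      simp only [Finset.card_range]
      linarith
    · obtain ⟨k, rfl⟩ := Nat.exists_eq_add_of_le h
      rw [Finset.sum_range_add, sum_range_shift_of_periodic hg]
      refine (abs_add_le _ _).trans ?_
      have h3 := ih k (by omega) (a + p)
      simp only [add_assoc] at h3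
      push_cast
      have h4 : (p + k : ℝ) * (E / p) = E + k * (E / p) := by
        field_simp
      rw [h4]
      linarith

theorem abs_sum_occDev_champ {m : ℕ} (hm : 0 < m) (w : List Bool) (a n : ℕ) :
    |∑ i ∈ Finset.range n, occDev (champ m) w (a + i)| ≤
      n * (w.length / m : ℝ) + (m * 2 ^ m : ℕ) := by
  have hm' : (0 : ℝ) < m := by exact_mod_cast hm
  have := abs_sum_le_of_periodic (by positivity) (occDev_champ_periodic hm w)
    (abs_occDev_le _ _) (abs_sum_occDev_champ_period hm w) a n
  refine this.trans (le_of_eq ?_)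
  push_cast
  field_simp

theorem abs_sum_occDev_stage (w : List Bool) {k a n : ℕ} (h1 : stageStart k ≤ a)
    (h2 : a + n ≤ stageStart (k + 1)) :
    |∑ i ∈ Finset.range n, occDev stagedSeq w (a + i)| ≤
      n * (w.length / blockLen k : ℝ) + blockLen (k + 1) + w.length := by
  -- The last `|w|` positions are split off, since occurrences there may reach into the next stage.
  obtain ⟨n', r, rfl, hr, hn'⟩ : ∃ n' r, n = n' + r ∧ r ≤ w.length ∧ (n' = 0 ∨ r = w.length) :=
    ⟨n - w.length, n - (n - w.length), by omega, by omega, by omega⟩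
  rw [Finset.sum_range_add]
  refine (abs_add_le _ _).trans ?_
  have h3 : ∑ i ∈ Finset.range n', occDev stagedSeq w (a + i) =
      ∑ i ∈ Finset.range n', occDev (champ (blockLen k)) w (a + i) := by
    refine Finset.sum_congr rfl fun i hi => occDev_congr fun j hj => ?_
    have := Finset.mem_range.1 hi
    exact stagedSeq_eq (by omega) (by omega)
  rw [h3]
  have h4 := abs_sum_occDev_champ (blockLen_pos k) w a n'
  have h5 : |∑ i ∈ Finset.range r, occDev stagedSeq w (a + (n' + i))| ≤ r := by
    simpa using abs_sum_le_card (Finset.range r) fun i => abs_occDev_le stagedSeq w (a + (n' + i))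
  have h6 : (r : ℝ) ≤ w.length := by exact_mod_cast hr
  have h7 : (0 : ℝ) ≤ r * (w.length / blockLen k : ℝ) := by positivity
  rw [← blockLen] at h4
  push_cast
  rw [add_mul]
  linarith

/-- This is the purpose of the square in `stageStart`: the previous starting position and the new
period are both negligible. -/
theorem stageStart_add_le_sqrt {k n : ℕ} (h : stageStart (k + 1) ≤ n) :
    (stageStart k : ℝ) + 4 * blockLen (k + 2) ≤ √n := by
  refine Real.le_sqrt_of_sq_le ?_
  exact_mod_cast h

/-- Everything before stage `k` is bounded trivially. Together with the periods of stages `k` and `k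
+ 1` it is absorbed by `√n`. -/
theorem abs_sum_occDev_stagedSeq (w : List Bool) {k n : ℕ} (h1 : stageStart (k + 1) ≤ n)
    (h2 : n ≤ stageStart (k + 2)) :
    |∑ i ∈ Finset.range n, occDev stagedSeq w i| ≤
      √n + n * (w.length / blockLen k : ℝ) + 2 * w.length := by
  have hs := stageStart_add_le_sqrt h1
  have hlt := stageStart_strictMono (Nat.lt_succ_self k)
  obtain ⟨a, ha⟩ := Nat.exists_eq_add_of_le hlt.le
  simp only [Nat.succ_eq_add_one] at ha
  obtain ⟨b, hb⟩ := Nat.exists_eq_add_of_le h1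
  have e1 := abs_sum_le_card (Finset.range (stageStart k)) (abs_occDev_le stagedSeq w)
  have e2 := abs_sum_occDev_stage w (k := k) (n := a) le_rfl ha.ge
  have e3 := abs_sum_occDev_stage w (k := k + 1) (n := b) le_rfl (by rw [← hb]; exact h2)
  rw [hb, Finset.sum_range_add]
  rw [ha] at e3 hb ⊢
  rw [Finset.sum_range_add, ← hb]
  simp only [Finset.card_range] at e1
  have hp : (blockLen (k + 1) : ℝ) ≤ blockLen (k + 2) := by
    exact_mod_cast (blockLen_strictMono (Nat.lt_succ_self (k + 1))).le
  have hm : (blockLen k : ℝ) ≤ blockLen (k + 1) := by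
    exact_mod_cast (blockLen_strictMono (Nat.lt_succ_self k)).le
  have hm0 : (0 : ℝ) < blockLen k := by exact_mod_cast blockLen_pos k
  have hp0 : (0 : ℝ) < blockLen (k + 1) := by exact_mod_cast blockLen_pos (k + 1)
  have e4 : (b : ℝ) * (w.length / blockLen (k + 1)) ≤ b * (w.length / blockLen k) := by gcongr
  have e5 : (0 : ℝ) ≤ stageStart k * (w.length / blockLen k) := by positivity
  have hb' : (n : ℝ) = stageStart k + a + b := by exact_mod_cast hb
  refine (abs_add_le _ _).trans ((add_le_add_left (abs_add_le _ _) _).trans ?_)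
  rw [show k + 1 + 1 = k + 2 from rfl] at e3
  rw [hb', add_mul, add_mul, ← hb']
  linarith

/-- Only `n - |w| + 1` starting positions fit into the prefix, while the sum runs over `n`; the
constant pays for the difference. -/
theorem abs_occ_sub_le (S : ℕ → Bool) (w : List Bool) {n : ℕ} (h : w.length ≤ n) :
    |(occ w (seqPrefix S n) : ℝ) - n * 2⁻¹ ^ w.length| ≤
      |∑ i ∈ Finset.range n, occDev S w i| + (2 * w.length + 2) := by
  classical
  obtain ⟨a, rfl⟩ := Nat.exists_eq_add_of_le' h
  have h1 : (occ w (seqPrefix S (a + w.length)) : ℝ) =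
      ∑ i ∈ Finset.range (a + 1), (if OccursAt S w i then (1 : ℝ) else 0) := by
    rw [occ_seqPrefix, Finset.sum_boole]
    congr 2
    ext i
    simp only [Finset.mem_filter, Finset.mem_range]
    constructor
    · rintro ⟨_, h2, h3⟩; exact ⟨by omega, h3⟩
    · rintro ⟨h2, h3⟩; exact ⟨by omega, by omega, h3⟩
  have h2 : ∑ i ∈ Finset.range (a + 1), (if OccursAt S w i then (1 : ℝ) else 0) =
      ∑ i ∈ Finset.range (a + 1), occDev S w i + (a + 1) * 2⁻¹ ^ w.length := by
    simp [occDev]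
  have h3 : ∑ i ∈ Finset.range (a + w.length), occDev S w i =
      ∑ i ∈ Finset.range a, occDev S w i +
        ∑ i ∈ Finset.range w.length, occDev S w (a + i) := Finset.sum_range_add _ _ _
  have h4 : |∑ i ∈ Finset.range w.length, occDev S w (a + i)| ≤ w.length := by
    simpa using abs_sum_le_card (Finset.range w.length) fun i => abs_occDev_le S w (a + i)
  have h5 := abs_occDev_le S w a
  have h6 : (0 : ℝ) ≤ 2⁻¹ ^ w.length := by positivity
  have h7 : (2⁻¹ : ℝ) ^ w.length ≤ 1 := pow_le_one₀ (by norm_num) (by norm_num)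
  have h8 : (0 : ℝ) ≤ w.length := by positivity
  rw [h1, h2, Finset.sum_range_succ]
  push_cast
  have h9 : ∑ i ∈ Finset.range a, occDev S w i + occDev S w a + (a + 1) * 2⁻¹ ^ w.length -
      (a + w.length) * 2⁻¹ ^ w.length = ∑ i ∈ Finset.range (a + w.length), occDev S w i +
      (occDev S w a - ∑ i ∈ Finset.range w.length, occDev S w (a + i) +
        (1 - w.length) * 2⁻¹ ^ w.length) := by rw [h3]; ring
  rw [h9]
  refine (abs_add_le _ _).trans ?_
  gcongr
  have h10 : |(1 - (w.length : ℝ)) * 2⁻¹ ^ w.length| ≤ 1 + w.length := by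
    rw [abs_mul, abs_of_nonneg h6]
    refine (mul_le_of_le_one_right (abs_nonneg _) h7).trans ?_
    rw [abs_le]; constructor <;> linarith
  refine (abs_add_le _ _).trans ((add_le_add (abs_sub _ _) h10).trans ?_)
  linarith

theorem stagedSeq_normal : IsNormalSeq stagedSeq := by
  intro w
  rw [tendsto_iff_norm_sub_tendsto_zero]
  -- The index is `stage n - 1` because the discrepancy in stage `k + 1` is governed by the shorter
  -- blocks of stage `k`.
  have hblock : Tendsto (fun n => ((blockLen (stage n - 1) : ℕ) : ℝ)) atTop atTop :=
    tendsto_natCast_atTop_atTop.comp (blockLen_strictMono.tendsto_atTop.comp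
      ((tendsto_sub_atTop_nat 1).comp tendsto_stage))
  have hlim : Tendsto (fun n : ℕ => 1 / √(n : ℝ) + w.length / (blockLen (stage n - 1) : ℝ) +
      (4 * w.length + 2) / (n : ℝ)) atTop (𝓝 (0 + 0 + 0)) := by
    refine (Tendsto.add ?_ ?_).add ?_
    · exact tendsto_const_nhds.div_atTop
        (Real.tendsto_sqrt_atTop.comp tendsto_natCast_atTop_atTop)
    · exact tendsto_const_nhds.div_atTop hblock
    · exact tendsto_const_nhds.div_atTop tendsto_natCast_atTop_atTop
  simp only [add_zero] at hlim
  refine squeeze_zero' (Eventually.of_forall fun _ => norm_nonneg _) ?_ hlim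
  filter_upwards [eventually_ge_atTop (max 1 (max w.length (stageStart 1)))] with n hn
  have hn1 : 1 ≤ n := le_trans (by simp) hn
  have hn2 : w.length ≤ n := le_trans (by simp) hn
  have hn3 : stageStart 1 ≤ n := le_trans (by simp) hn
  obtain ⟨k, hk⟩ := Nat.exists_eq_add_of_le' (le_stage hn3)
  have hspec := stage_spec n
  rw [hk] at hspec ⊢
  have hn0 : (0 : ℝ) < n := by exact_mod_cast hn1
  have h1 := abs_sum_occDev_stagedSeq w hspec.1 hspec.2.le
  have h2 := (abs_occ_sub_le stagedSeq w hn2).trans (add_le_add_left h1 _)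
  rw [Real.norm_eq_abs, show (occ w (seqPrefix stagedSeq n) : ℝ) / n - 2⁻¹ ^ w.length =
    ((occ w (seqPrefix stagedSeq n) : ℝ) - n * 2⁻¹ ^ w.length) / n by field_simp, abs_div,
    abs_of_pos hn0, div_le_iff₀ hn0]
  refine h2.trans (le_of_eq ?_)
  have h3 : 1 / √(n : ℝ) * n = √n := by
    rw [one_div, inv_mul_eq_div, Real.div_sqrt]
  have h4 : (4 * w.length + 2) / (n : ℝ) * n = 4 * w.length + 2 := div_mul_cancel₀ _ hn0.ne'
  rw [add_mul, add_mul, h3, h4, Nat.add_sub_cancel]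
  ring

/-! ### The code length -/

namespace PPMStar

theorem bitProb_pos (x : List Bool) (b : Bool) : 0 < bitProb x b :=
  lt_of_lt_of_le (by positivity) (le_bitProb x b)

theorem finalInterval_width_pos (S : ℕ → Bool) (n : ℕ) :
    0 < (finalInterval (seqPrefix S n)).width := by
  induction n with
  | zero => simp [seqPrefix, finalInterval, encodeFrom]
  | succ n ih =>
    rw [seqPrefix_succ, finalInterval_width_append]
    exact mul_pos ih (bitProb_pos _ _)

/-- The number of binary digits that the bit at the position `n` of `S` contributes. -/
noncomputable def bitCost (S : ℕ → Bool) (n : ℕ) : ℝ :=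
  -Real.logb 2 (bitProb (seqPrefix S n) (S n) : ℚ)

theorem neg_logb_width (S : ℕ → Bool) (n : ℕ) :
    -Real.logb 2 ((finalInterval (seqPrefix S n)).width : ℝ) =
      ∑ i ∈ Finset.range n, bitCost S i := by
  induction n with
  | zero => simp [seqPrefix, finalInterval, encodeFrom]
  | succ n ih =>
    have h1 : ((finalInterval (seqPrefix S n)).width : ℝ) ≠ 0 := by
      exact_mod_cast (finalInterval_width_pos S n).ne'
    have h2 : (bitProb (seqPrefix S n) (S n) : ℝ) ≠ 0 := by
      exact_mod_cast (bitProb_pos _ _).ne'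
    rw [Finset.sum_range_succ, ← ih, seqPrefix_succ, finalInterval_width_append, Rat.cast_mul,
      Real.logb_mul h1 h2, bitCost]
    ring

theorem bitCost_le (S : ℕ → Bool) (n : ℕ) : bitCost S n ≤ 2 * Real.logb 2 (2 * n + 4) := by
  have h := le_bitProb (seqPrefix S n) (S n)
  rw [seqPrefix_length] at h
  have h' : ((1 : ℝ) / (2 * n + 4)) ^ 2 ≤ (bitProb (seqPrefix S n) (S n) : ℚ) := by
    have := (Rat.cast_le (K := ℝ)).2 h
    push_cast at this
    exact this
  have h2 := Real.logb_le_logb_of_le (b := 2) (by norm_num) (by positivity) h'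
  rw [Real.logb_pow, one_div, Real.logb_inv] at h2
  rw [bitCost]
  push_cast at h2
  linarith

theorem bitCost_le_of_le_bitProb {S : ℕ → Bool} {n K : ℕ} (hK : 0 < K)
    (h : (K : ℚ) / (K + 1) ≤ bitProb (seqPrefix S n) (S n)) : bitCost S n ≤ 2 / K := by
  have hK' : (0 : ℝ) < K := by exact_mod_cast hK
  have h' : (K : ℝ) / (K + 1) ≤ (bitProb (seqPrefix S n) (S n) : ℚ) := by
    have := (Rat.cast_le (K := ℝ)).2 h
    push_cast at this
    exact this
  have h2 := Real.logb_le_logb_of_le (b := 2) (by norm_num) (by positivity) h'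
  have h3 : Real.log ((K + 1) / K) ≤ 1 / K := by
    refine (Real.log_le_sub_one_of_pos (by positivity)).trans (le_of_eq ?_)
    field_simp
    ring
  have h4 : Real.logb 2 (K / (K + 1)) = -(Real.log ((K + 1) / K) / Real.log 2) := by
    rw [← inv_div, Real.logb_inv, Real.logb]
  have h5 : Real.log ((K + 1) / K) / Real.log 2 ≤ 2 / K := by
    -- Only `log 2 ≥ 1 / 2` is needed.
    have := Real.log_two_gt_d9
    rw [div_le_iff₀ (by linarith)]
    refine h3.trans ?_
    rw [show 2 / (K : ℝ) * Real.log 2 = 1 / K * (2 * Real.log 2) by ring]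
    exact le_mul_of_one_le_right (by positivity) (by linarith)
  rw [bitCost]
  linarith

theorem ppmStar_length_le (S : ℕ → Bool) (n : ℕ) (h : 0 ≤ ∑ i ∈ Finset.range n, bitCost S i) :
    ((ppmStar (seqPrefix S n)).length : ℝ) ≤ ∑ i ∈ Finset.range n, bitCost S i + 2 := by
  rw [ppmStar, output_length, codeLength, neg_logb_width]
  push_cast
  -- Rounding up costs less than one digit; the overhead bit is the other.
  have := Nat.ceil_lt_add_one h
  linarith

theorem probIn_le_one (x : List Bool) (b : Bool) (l : List (List Bool)) : probIn x b l ≤ 1 := by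
  induction l with
  | nil => norm_num [probIn]
  | cons c l ih =>
    unfold probIn
    split_ifs
    · refine div_le_one_of_le₀ ?_ (by positivity)
      unfold total
      cases b <;> push_cast <;> nlinarith [Nat.cast_nonneg (α := ℚ) (count x c false),
        Nat.cast_nonneg (α := ℚ) (count x c true), Nat.cast_nonneg (α := ℚ) (escCount x c)]
    · have h1 : (escCount x c : ℚ) / total x c ≤ 1 := by
        refine div_le_one_of_le₀ ?_ (by positivity)
        unfold total
        push_cast
        nlinarith [Nat.cast_nonneg (α := ℚ) (count x c false),
          Nat.cast_nonneg (α := ℚ) (count x c true)]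
      exact (mul_le_of_le_one_right (by positivity) ih).trans h1

theorem bitCost_nonneg (S : ℕ → Bool) (n : ℕ) : 0 ≤ bitCost S n := by
  rw [bitCost, neg_nonneg]
  refine Real.logb_nonpos (by norm_num) ?_ ?_
  · exact_mod_cast (bitProb_pos _ _).le
  · exact_mod_cast probIn_le_one _ _ _

/-! ### Total cost of the staged sequence -/

theorem bitCost_stagedSeq_le {k L t : ℕ}
    (hL : L = stageStart k + 2 * blockLen (k + 2) + blockLen (k + 1)) (ht : blockLen (k + 2) ≤ t)
    (h : stageStart (k + 1) + L + t < stageStart (k + 2)) :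
    bitCost stagedSeq (stageStart (k + 1) + L + t) ≤ 4 * blockLen (k + 2) * (t + 1 : ℝ)⁻¹ := by
  have hp : 0 < blockLen (k + 2) := blockLen_pos _
  set p := blockLen (k + 2)
  have hK : 0 < t / p := Nat.div_pos ht hp
  have h1 := Nat.div_add_mod t p
  have h2 := Nat.mod_lt t hp
  rw [mul_comm] at h1
  refine (bitCost_le_of_le_bitProb hK
    (le_bitProb_stagedSeq hL hK (by change _ + t / p * p ≤ _; omega) h)).trans ?_
  have hK' : (0 : ℝ) < (t / p : ℕ) := by exact_mod_cast hK
  -- With `K = t / p ≥ 1` one has `t < (K + 1) p ≤ 2 K p`, which turns `2 / K` into a harmonic term.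
  have h3 : t + 1 ≤ 2 * (t / p * p) := by
    have : p ≤ t / p * p := Nat.le_mul_of_pos_left p hK
    omega
  have h4 : (t + 1 : ℝ) ≤ 2 * ((t / p : ℕ) * p) := by exact_mod_cast h3
  rw [← div_eq_mul_inv, div_le_div_iff₀ hK' (by positivity)]
  linarith

theorem sum_bitCost_le (S : ℕ → Bool) {a b n : ℕ} (h : a + b ≤ n) :
    ∑ i ∈ Finset.range b, bitCost S (a + i) ≤ b * (2 * Real.logb 2 (2 * n + 4)) := by
  have h1 : ∀ i ∈ Finset.range b, bitCost S (a + i) ≤ 2 * Real.logb 2 (2 * n + 4) := by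
    intro i hi
    have hi' := Finset.mem_range.1 hi
    refine (bitCost_le S _).trans ?_
    have h2 : ((a + i : ℕ) : ℝ) ≤ n := by exact_mod_cast (by omega : a + i ≤ n)
    have := Real.logb_le_logb_of_le (b := 2) (x := 2 * ((a + i : ℕ) : ℝ) + 4) (y := 2 * n + 4)
      (by norm_num) (by positivity) (by linarith)
    linarith
  simpa using Finset.sum_le_card_nsmul _ _ _ h1

/-- The factor in the bounds for the total cost: the largest cost of one of the first `n` bits, and a
bound for the harmonic sum of the costs of well predicted bits. -/
noncomputable def costBound (n : ℕ) : ℝ :=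
  2 * Real.logb 2 (2 * n + 4) + (1 + Real.log n)

theorem sum_bitCost_stage_le {k b n : ℕ} (hb : stageStart (k + 1) + b ≤ stageStart (k + 2))
    (hn : stageStart (k + 1) + b ≤ n) (hn0 : 0 < n) :
    ∑ i ∈ Finset.range b, bitCost stagedSeq (stageStart (k + 1) + i) ≤
      (stageStart k + 4 * blockLen (k + 2)) * costBound n := by
  obtain ⟨L, hL⟩ : ∃ L, L = stageStart k + 2 * blockLen (k + 2) + blockLen (k + 1) := ⟨_, rfl⟩
  have hpp : blockLen (k + 1) < blockLen (k + 2) := blockLen_strictMono (Nat.lt_succ_self _)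
  -- The first `L + p` bits of the stage get the crude bound, the later ones the harmonic one. The
  -- first group has at most `stageStart k + 4 p` bits because `p' < p`.
  obtain ⟨b', r, rfl, hb', hr⟩ : ∃ b' r, b = b' + r ∧ b' ≤ L + blockLen (k + 2) ∧
      (r = 0 ∨ b' = L + blockLen (k + 2)) :=
    ⟨min b (L + blockLen (k + 2)), b - min b (L + blockLen (k + 2)), by omega, by omega, by omega⟩
  have hs : (b' : ℝ) ≤ stageStart k + 4 * blockLen (k + 2) := by
    exact_mod_cast (by omega : b' ≤ stageStart k + 4 * blockLen (k + 2))
  have hlog : 0 ≤ Real.logb 2 (2 * n + 4) := by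
    refine Real.logb_nonneg (by norm_num) ?_
    have : (0 : ℝ) ≤ n := by positivity
    linarith
  have hn1 : (1 : ℝ) ≤ n := by exact_mod_cast hn0
  have hlog' : 0 ≤ Real.log n := Real.log_nonneg hn1
  rw [Finset.sum_range_add, costBound, mul_add]
  refine add_le_add ?_ ?_
  · refine (sum_bitCost_le stagedSeq (n := n) (by omega)).trans ?_
    gcongr
  · have h1 : ∀ i ∈ Finset.range r, bitCost stagedSeq (stageStart (k + 1) + (b' + i)) ≤
        4 * blockLen (k + 2) * (i + 1 : ℝ)⁻¹ := by
      intro i hi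
      have hi' := Finset.mem_range.1 hi
      have hb2 : b' = L + blockLen (k + 2) := by omega
      rw [show stageStart (k + 1) + (b' + i) = stageStart (k + 1) + L + (blockLen (k + 2) + i) by
        omega]
      refine (bitCost_stagedSeq_le hL (by omega) (by omega)).trans ?_
      have : (0 : ℝ) ≤ blockLen (k + 2) := by positivity
      push_cast
      gcongr
      linarith
    refine (Finset.sum_le_sum h1).trans ?_
    rw [← Finset.mul_sum]
    have h2 : ∑ i ∈ Finset.range r, (i + 1 : ℝ)⁻¹ ≤ 1 + Real.log n := by
      have h3 := harmonic_le_one_add_log r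
      have h4 : ((harmonic r : ℚ) : ℝ) = ∑ i ∈ Finset.range r, (i + 1 : ℝ)⁻¹ := by
        simp [harmonic]
      rw [← h4]
      refine h3.trans ?_
      rcases Nat.eq_zero_or_pos r with h0 | h0
      · simpa [h0] using hlog'
      · have : (r : ℝ) ≤ n := by exact_mod_cast (by omega : r ≤ n)
        gcongr
    have h5 : (0 : ℝ) ≤ stageStart k := by positivity
    refine mul_le_mul (by linarith) h2 ?_ (by positivity)
    positivity

/-- One `√n` each for the current stage, for the stage before it, and for all older bits; the older
bits are so few that the crude bound suffices. -/
theorem sum_bitCost_stagedSeq_le {n : ℕ} (h : stageStart 2 ≤ n) :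
    ∑ i ∈ Finset.range n, bitCost stagedSeq i ≤ 3 * √n * costBound n := by
  obtain ⟨k, hk⟩ := Nat.exists_eq_add_of_le' (le_stage h)
  obtain ⟨h1, h2⟩ := stage_spec n
  rw [hk] at h1 h2
  change stageStart (k + 1 + 1) ≤ n at h1
  have hs2 := stageStart_add_le_sqrt (k := k + 1) h1
  have hlt := stageStart_strictMono (Nat.lt_succ_self (k + 1))
  simp only [Nat.succ_eq_add_one] at hlt
  have hM : (stageStart k + 4 * blockLen (k + 2) : ℝ) ≤ stageStart (k + 1) := by
    exact_mod_cast (stageStart_add_lt k).le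
  have hp0 : (0 : ℝ) ≤ blockLen (k + 1 + 2) := by positivity
  have hM' : (stageStart (k + 1) : ℝ) ≤ √n := by linarith
  have hn0 : 0 < n := by omega
  have hlog : 0 ≤ Real.logb 2 (2 * n + 4) := by
    refine Real.logb_nonneg (by norm_num) ?_
    have : (0 : ℝ) ≤ n := by positivity
    linarith
  have hlog' : 0 ≤ Real.log n := Real.log_nonneg (by exact_mod_cast hn0)
  have hG : 0 ≤ costBound n := by rw [costBound]; positivity
  obtain ⟨a, ha⟩ := Nat.exists_eq_add_of_le hlt.le
  obtain ⟨b, hb⟩ := Nat.exists_eq_add_of_le h1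
  have e1 := sum_bitCost_le stagedSeq (a := 0) (b := stageStart (k + 1)) (n := n) (by omega)
  have e2 := sum_bitCost_stage_le (k := k) (b := a) (n := n) ha.ge
    (by rw [← ha]; exact h1) hn0
  have e3 := sum_bitCost_stage_le (k := k + 1) (b := b) (n := n) (by rw [← hb]; exact h2.le)
    hb.ge hn0
  have hsum : ∑ i ∈ Finset.range n, bitCost stagedSeq i =
      ∑ i ∈ Finset.range (stageStart (k + 1)), bitCost stagedSeq (0 + i) +
      ∑ i ∈ Finset.range a, bitCost stagedSeq (stageStart (k + 1) + i) +
      ∑ i ∈ Finset.range b, bitCost stagedSeq (stageStart (k + 1 + 1) + i) := by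
    conv_lhs => rw [hb, Finset.sum_range_add, show stageStart (k + 2) = _ from ha,
      Finset.sum_range_add, ← ha]
    simp only [zero_add]
  have f1 : (stageStart (k + 1) : ℝ) * (2 * Real.logb 2 (2 * n + 4)) ≤ √n * costBound n := by
    refine mul_le_mul hM' ?_ (by positivity) (by positivity)
    rw [costBound]; linarith
  have f2 := mul_le_mul_of_nonneg_right (hM.trans hM') hG
  have f3 := mul_le_mul_of_nonneg_right hs2 hG
  rw [hsum]
  linarith

theorem costBound_le {n : ℕ} (h : 4 ≤ n) : costBound n ≤ 10 * Real.log n := by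
  have hn : (4 : ℝ) ≤ n := by exact_mod_cast h
  have h2 := Real.log_two_gt_d9
  have h1 : 1 ≤ Real.log n := by
    have h3 := Real.log_le_log (by norm_num) hn
    rw [show (4 : ℝ) = 2 ^ 2 by norm_num, Real.log_pow] at h3
    push_cast at h3
    linarith
  have h4 : Real.log (2 * n + 4) ≤ 2 * Real.log n := by
    have : Real.log (2 * n + 4) ≤ Real.log ((n : ℝ) ^ 2) :=
      Real.log_le_log (by positivity) (by nlinarith)
    rwa [Real.log_pow] at this
  have h5 : Real.logb 2 (2 * n + 4) ≤ 4 * Real.log n := by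
    rw [Real.logb, div_le_iff₀ (by linarith)]
    nlinarith
  rw [costBound]
  linarith

end PPMStar

theorem worstCaseRatio_ppmStar_stagedSeq : worstCaseRatio ppmStar stagedSeq = 0 := by
  have hlim : Tendsto (fun n : ℕ => 30 * (Real.log n / √(n : ℝ)) + 2 / (n : ℝ)) atTop
      (𝓝 (30 * 0 + 0)) := by
    refine (Tendsto.const_mul _ ?_).add (tendsto_const_nhds.div_atTop tendsto_natCast_atTop_atTop)
    have := (isLittleO_log_rpow_atTop (r := 1 / 2) (by norm_num)).tendsto_div_nhds_zero
    simp only [← Real.sqrt_eq_rpow] at this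
    exact this.comp tendsto_natCast_atTop_atTop
  simp only [mul_zero, add_zero] at hlim
  have hreal : Tendsto (fun n : ℕ => ((ppmStar (seqPrefix stagedSeq n)).length : ℝ) / n) atTop
      (𝓝 0) := by
    refine squeeze_zero' (Eventually.of_forall fun _ => by positivity) ?_ hlim
    filter_upwards [eventually_ge_atTop (max 4 (stageStart 2))] with n hn
    have hn1 : 4 ≤ n := le_trans (by simp) hn
    have hn2 : stageStart 2 ≤ n := le_trans (by simp) hn
    have hn0 : (0 : ℝ) < n := by exact_mod_cast (by omega : 0 < n)
    have h1 := PPMStar.ppmStar_length_le stagedSeq n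
      (Finset.sum_nonneg fun i _ => PPMStar.bitCost_nonneg _ _)
    have h2 := PPMStar.sum_bitCost_stagedSeq_le hn2
    have h3 : 3 * √(n : ℝ) * PPMStar.costBound n ≤ 3 * √(n : ℝ) * (10 * Real.log n) := by
      gcongr
      exact PPMStar.costBound_le hn1
    have h4 : Real.log n / √(n : ℝ) * n = Real.log n * √n := by
      rw [div_mul_eq_mul_div, mul_div_assoc, Real.div_sqrt]
    rw [div_le_iff₀ hn0, add_mul, mul_assoc, h4, div_mul_cancel₀ _ hn0.ne']
    linarith
  -- The real quotient agrees with the one in `[0, ∞]` as soon as `n > 0`.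
  have hE := ENNReal.tendsto_ofReal hreal
  rw [ENNReal.ofReal_zero] at hE
  refine (hE.congr' ?_).limsup_eq
  filter_upwards [eventually_gt_atTop 0] with n hn
  rw [ENNReal.ofReal_div_of_pos (by exact_mod_cast hn), ENNReal.ofReal_natCast,
    ENNReal.ofReal_natCast]

theorem corollary2 :
    ∃ S : ℕ → Bool, IsNormalSeq S ∧ worstCaseRatio ppmStar S = 0 :=
  ⟨stagedSeq, stagedSeq_normal, worstCaseRatio_ppmStar_stagedSeq⟩
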